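/- Setting. Let $\mathcal M_1,\dots,\mathcal M_K$ be sets of probability distributions on $\mathbb R$ with finite mean, and let $\mathcal E=\prod_{k=1}^K\mathcal M_k$ be the corresponding unstructured class of $K$-armed bandit instances $\nu=(\nu_k)_{k\in[K]}$. Write $\mu(P)$ for the mean of $P$, $\mu^*=\max_k\mu(\nu_k)$ and $\Delta_k=\mu^*-\mu(\nu_k)$. Let $\mathcal G=(V,E)$ be a finite connected graph with $|V|=M$ agents and graph distance $d$. In each round $t=1,2,\dots$ every agent $m$ pulls an arm $A_{m,t}\in[K]$ and receives a reward $X_{m,t}$; given everything observed before round $t$, the pairs $(A_{m,t},X_{m,t})$, $m\in V$, are independent, and given $A_{m,t}$ the reward has law $\nu_{A_{m,t}}$. Communication. At the end of round $s$ agent $m$ emits the message $q_m(s)=F_{m,s}(A_{m,1},X_{m,1},\dots,A_{m,s},X_{m,s})$, where $F_{m,s}:\mathbb R^{2s}\to\mathbb R^{2s}$ is a deterministic differentiable bijection for which $|\det J_{F_{m,s}}|$ is a constant depending only on $m$ and $s$. It is received by agent $m'\ne m$ at the end of round $s+d(m,m')-1$ at the earliest, so that $m'$ can use it from round $s+d(m,m')$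 on. Policies. A cooperative policy consists of such a communication protocol together with, for every agent $m$ and every round $t$, a probability kernel $\pi_{m,t}$ that draws $A_{m,t}$ given the agent's own pairs $(A_{m,s},X_{m,s})_{s<t}$ and the messages $q_{m'}(s)$, $m'\neq m$, $s+d(m',m)\le t$. A policy may depend on the horizon: let $\Pi=(\Pi^{(T)})_{T}$ be a family of policies, $\Pi^{(T)}$ being used for horizon $T$. For an instance $\nu$, let $N_k(T)$ be the total number of pulls of arm $k$ by all agents in the first $T$ rounds, and let $$R_{\mathcal G}(T)=\mathbb E_{\nu\Pi^{(T)}}\Big[\mu^*TM-\sum_{m\in V}\sum_{t=1}^T\mu(\nu_{A_{m,t}})\Big]$$ be the (expected) group regret. $\Pi$ is consistent on $\mathcal E$ if for every instance in $\mathcal E$, every arm $k$ that is suboptimal for that instance and every $a>0$ one has $\mathbb E[N_k(T)]=o(T^a)$ as $T\to\infty$, the expectation being taken under that instance. Theorem. Let $\Pi$ be consistent on $\mathcal E$. Then for every $\nu\in\mathcal E$, $$\liminf_{T\to\infty}\frac{R_{\mathcal G}(T)}{\ln T}\ \ge\ \sum_{k:\Delta_k>0}\frac{\Delta_k}{\mathbb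 D^{\inf}_k},\qquad \mathbb D^{\inf}_k=\inf\big\{\mathbb D_{\mathsf{KL}}(\nu_k,P):P\in\mathcal M_k,\ \mu(P)>\mu^*\big\},$$ where both sides are taken in $[-\infty,\infty]$, with $\inf\emptyset=\infty$, $\Delta_k/\infty=0$ and $\Delta_k/0=\infty$. -/

import Mathlib

open MeasureTheory ProbabilityTheory Filter Topology
open scoped ENNReal

/-! ### Bandit instances -/

/-- The mean `μ(P)` of a reward distribution. -/
noncomputable def mean (P : ProbabilityMeasure ℝ) : ℝ := ∫ x, x ∂(P : Measure ℝ)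

/-- A `K`-armed bandit instance `ν = (ν_k)`. -/
abbrev Bandit (K : ℕ) : Type := Fin K → ProbabilityMeasure ℝ

/-- The unstructured environment class `∏ₖ 𝓜ₖ`. -/
def envClass {K : ℕ} (𝓜 : Fin K → Set (ProbabilityMeasure ℝ)) : Set (Bandit K) :=
  {ν | ∀ k, ν k ∈ 𝓜 k}

/-- The best mean `μ* = maxₖ μ(ν_k)`. -/
noncomputable def bestMean {K : ℕ} (ν : Bandit K) : ℝ := ⨆ k, mean (ν k)

/-- The suboptimality gap `Δ_k = μ* - μ(ν_k)`. -/
noncomputable def gap {K : ℕ} (ν : Bandit K) (k : Fin K) : ℝ := bestMean ν - mean (ν k)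

/-- `D^inf_k = inf {KL(ν_k, P) : P ∈ 𝓜_k, μ(P) > μ*}`, which is `∞` if there is no such `P`. -/
noncomputable def Dinf {K : ℕ} (𝓜 : Fin K → Set (ProbabilityMeasure ℝ)) (ν : Bandit K)
    (k : Fin K) : ℝ≥0∞ :=
  ⨅ P ∈ {P : ProbabilityMeasure ℝ | P ∈ 𝓜 k ∧ bestMean ν < mean P},
    InformationTheory.klDiv (ν k : Measure ℝ) (P : Measure ℝ)

/-! ### Communication

Rounds are numbered `0, 1, 2, …`; at the end of round `s` an agent owns the `s + 1` action-reward
pairs of the rounds `0, …, s`, a point of `ℝ ^ (2 (s + 1)) = (ℝ × ℝ) ^ (s + 1)`. -/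

/-- A communication protocol: at the end of round `s`, agent `m` emits the message
`encode m s (A₀, X₀, …, A_s, X_s)`, where `encode m s` is a deterministic differentiable bijection
of `ℝ ^ (2 (s + 1))` whose Jacobian determinant has an absolute value that depends only
on `m` and `s`. -/
structure CommProtocol (V : Type*) where
  encode : (m : V) → (s : ℕ) → (Fin (s + 1) → ℝ × ℝ) → (Fin (s + 1) → ℝ × ℝ)
  bijective : ∀ m s, Function.Bijective (encode m s)
  differentiable : ∀ m s, Differentiable ℝ (encode m s)
  abs_det_jacobian : ∀ m s, ∃ Λ : ℝ, ∀ z, |(fderiv ℝ (encode m s) z).det| = Λ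

/-- The joint action-reward history of all agents in the rounds `0, …, t - 1`. -/
abbrev Hist (V : Type*) (K t : ℕ) : Type _ := Fin t → V → Fin K × ℝ

/-- The messages that can have reached agent `m` when it acts in round `t`, as pairs
(sender, round of emission): those of the other agents `m'` emitted in a round `s` with
`s + d(m', m) ≤ t`. (They are received at the end of round `s + d(m', m) - 1` at the earliest.) -/
abbrev Inbox {V : Type*} (G : SimpleGraph V) (m : V) (t : ℕ) : Type _ :=
  {p : V × Fin t // p.1 ≠ m ∧ (p.2 : ℕ) + G.dist p.1 m ≤ t}

/-- The information of agent `m` when it acts in round `t`: its own action-reward pairs, and the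
received messages. -/
abbrev Info {V : Type*} (G : SimpleGraph V) (K : ℕ) (m : V) (t : ℕ) : Type _ :=
  (Fin t → Fin K × ℝ) × ((p : Inbox G m t) → Fin ((p.1.2 : ℕ) + 1) → ℝ × ℝ)

/-- An action-reward pair as a point of `ℝ × ℝ`; the arms are numbered `1, …, K`. -/
def pairToReal {K : ℕ} (y : Fin K × ℝ) : ℝ × ℝ := (((y.1 : ℕ) : ℝ) + 1, y.2)

/-- What agent `m` knows when it acts in round `t`, given the joint history. -/
def info {V : Type*} {G : SimpleGraph V} {K : ℕ} (F : CommProtocol V) (m : V) (t : ℕ)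
    (h : Hist V K t) : Info G K m t :=
  (fun s ↦ h s m,
    fun p ↦ F.encode p.1.1 p.1.2
      fun i ↦ pairToReal (h ⟨i, lt_of_lt_of_le i.isLt p.1.2.isLt⟩ p.1.1))

/-! ### Policies -/

/-- A cooperative multi-agent policy for `K` arms on the graph `G`: a communication protocol and,
for every agent `m` and round `t`, a probability kernel from the information of `m`
to the arms. -/
structure CoopPolicy {V : Type*} (G : SimpleGraph V) (K : ℕ) where
  protocol : CommProtocol V
  kernel : (m : V) → (t : ℕ) → Kernel (Info G K m t) (Fin K)
  markov : ∀ m t, IsMarkovKernel (kernel m t)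

attribute [instance] CoopPolicy.markov

/-! ### The law of the interaction of a policy with a bandit instance -/

theorem measurable_pairToReal {K : ℕ} : Measurable (pairToReal (K := K)) := by
  unfold pairToReal
  refine Measurable.prodMk ?_ measurable_snd
  exact (measurable_of_countable fun k : Fin K ↦ ((k : ℕ) : ℝ) + 1).comp measurable_fst

theorem measurable_info {V : Type*} {G : SimpleGraph V} {K : ℕ} (F : CommProtocol V) (m : V)
    (t : ℕ) : Measurable (info (G := G) (K := K) F m t) := by
  unfold info
  refine Measurable.prodMk ?_ ?_
  · fun_prop
  · refine measurable_pi_lambda _ fun p ↦ ?_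
    refine (F.differentiable p.1.1 p.1.2).continuous.measurable.comp ?_
    refine measurable_pi_lambda _ fun i ↦ measurable_pairToReal.comp ?_
    fun_prop

/-- The reward kernel: arm `k` yields a reward with law `ν k`. -/
noncomputable def rewardKernel {K : ℕ} (ν : Bandit K) : Kernel (Fin K) ℝ where
  toFun k := (ν k : Measure ℝ)
  measurable' := measurable_of_countable _

instance {K : ℕ} (ν : Bandit K) : IsMarkovKernel (rewardKernel ν) :=
  ⟨fun k ↦ inferInstanceAs (IsProbabilityMeasure (ν k : Measure ℝ))⟩

/-- The conditional law of the action-reward pair of agent `m` in round `t`, given the joint history: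
an arm drawn from the agent's kernel, then a reward of that arm. -/
noncomputable def agentKernel {V : Type*} {G : SimpleGraph V} {K : ℕ} (Pi : CoopPolicy G K)
    (ν : Bandit K) (m : V) (t : ℕ) : Kernel (Hist V K t) (Fin K × ℝ) :=
  (Pi.kernel m t).comap (info Pi.protocol m t) (measurable_info Pi.protocol m t) ⊗ₖ
    (rewardKernel ν).comap Prod.snd measurable_snd

instance {V : Type*} {G : SimpleGraph V} {K : ℕ} (Pi : CoopPolicy G K)
    (ν : Bandit K) (m : V) (t : ℕ) : IsMarkovKernel (agentKernel Pi ν m t) := by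
  unfold agentKernel
  infer_instance

/-- The conditional law of round `t` given the joint history: the agents act independently. -/
noncomputable def roundKernel {V : Type*} [Fintype V] {G : SimpleGraph V} {K : ℕ}
    (Pi : CoopPolicy G K) (ν : Bandit K) (t : ℕ) : Kernel (Hist V K t) (V → Fin K × ℝ) where
  toFun h := Measure.pi fun m ↦ agentKernel Pi ν m t h
  measurable' := by
    refine Measurable.measure_of_isPiSystem_of_isProbabilityMeasure
      generateFrom_pi.symm isPiSystem_pi ?_
    rintro _ ⟨s, hs, rfl⟩
    simp only [Measure.pi_pi]
    exact Finset.measurable_prod _ fun m _ ↦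
      Kernel.measurable_coe _ (hs m (Set.mem_univ m))

instance {V : Type*} [Fintype V] {G : SimpleGraph V} {K : ℕ} (Pi : CoopPolicy G K)
    (ν : Bandit K) (t : ℕ) : IsMarkovKernel (roundKernel Pi ν t) :=
  ⟨fun h ↦ inferInstanceAs (IsProbabilityMeasure (Measure.pi fun m ↦ agentKernel Pi ν m t h))⟩

/-- The law `ℙ_{νΠ}` of the joint history of the first `t` rounds. -/
noncomputable def law {V : Type*} [Fintype V] {G : SimpleGraph V} {K : ℕ}
    (Pi : CoopPolicy G K) (ν : Bandit K) : (t : ℕ) → Measure (Hist V K t)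
  | 0 => Measure.dirac fun i ↦ i.elim0
  | t + 1 => (law Pi ν t ⊗ₘ roundKernel Pi ν t).map
      fun p ↦ Fin.snoc (α := fun _ ↦ V → Fin K × ℝ) p.1 p.2

theorem measurable_snoc {V : Type*} {K t : ℕ} :
    Measurable fun p : Hist V K t × (V → Fin K × ℝ) ↦
      (Fin.snoc (α := fun _ ↦ V → Fin K × ℝ) p.1 p.2 : Hist V K (t + 1)) := by
  refine measurable_pi_lambda _ fun i ↦ ?_
  refine Fin.lastCases ?_ (fun j ↦ ?_) i
  · simpa using measurable_snd
  · simp only [Fin.snoc_castSucc]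
    exact (measurable_pi_apply j).comp measurable_fst

instance isProbabilityMeasure_law {V : Type*} [Fintype V] {G : SimpleGraph V} {K : ℕ}
    (Pi : CoopPolicy G K) (ν : Bandit K) (t : ℕ) : IsProbabilityMeasure (law Pi ν t) := by
  induction t with
  | zero => exact inferInstanceAs (IsProbabilityMeasure (Measure.dirac _))
  | succ t ih => exact Measure.isProbabilityMeasure_map measurable_snoc.aemeasurable

/-! ### Pulls, regret, consistency -/

/-- The expected total number `𝔼[N_k(T)]` of pulls of arm `k` by all agents in `T` rounds. -/
noncomputable def expectedPulls {V : Type*} [Fintype V] {G : SimpleGraph V} {K : ℕ}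
    (Pi : CoopPolicy G K) (ν : Bandit K) (T : ℕ) (k : Fin K) : ℝ :=
  ∫ h, (∑ v : V, ∑ t : Fin T, if (h t v).1 = k then (1 : ℝ) else 0) ∂(law Pi ν T)

/-- The expected group regret `R_G(T) = 𝔼[μ* T |V| - ∑ᵥ ∑ₜ μ_{A_{v,t}}]`. -/
noncomputable def groupRegret {V : Type*} [Fintype V] {G : SimpleGraph V} {K : ℕ}
    (Pi : CoopPolicy G K) (ν : Bandit K) (T : ℕ) : ℝ :=
  ∫ h, (bestMean ν * T * Fintype.card V - ∑ v : V, ∑ t : Fin T, mean (ν (h t v).1))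
    ∂(law Pi ν T)

/-- A family of policies, `Pi T` being used for the horizon `T`, is consistent on the class `∏ₖ 𝓜ₖ`
if for every instance in it and every suboptimal arm `k`, `𝔼[N_k(T)] = o(T ^ a)` for
all `a > 0`. A policy that does not depend on the horizon is a constant family. -/
def IsConsistent {V : Type*} [Fintype V] {G : SimpleGraph V} {K : ℕ}
    (𝓜 : Fin K → Set (ProbabilityMeasure ℝ)) (Pi : ℕ → CoopPolicy G K) : Prop :=
  ∀ ν ∈ envClass 𝓜, ∀ k, 0 < gap ν k → ∀ a : ℝ, 0 < a →
    (fun T : ℕ ↦ expectedPulls (Pi T) ν T k) =o[atTop] fun T : ℕ ↦ (T : ℝ) ^ a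

/-! ### Densities of product measures and of the law of the interaction -/

/-! The proof is a change of measure on the joint history of all agents. Fix a suboptimal arm `k`
and replace its law by some `P ∈ 𝓜 k` with mean above `μ*`. Messages are deterministic functions of
the joint history, so each arm choice has the same kernel under both instances. The arm kernels
cancel, and the likelihood ratio is the product of the reward densities over the pulls of `k`
(`law_eq_withDensity`). Its expected logarithm is `KL(ν_k, P) 𝔼[N_k(T)]`.

With `M` agents, the event `N_k(T) ≥ MT/2` is rare under `ν`, and its complement is rare under the
modified instance, where `k` is the unique best arm: by Markov and consistency both probabilities
are `o(T^(a-1))`. Bretagnolle–Huber (`exp_neg_klDiv_mul_expectedPulls_le`) then gives `KL(ν_k, P)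
𝔼[N_k(T)] ≥ (1 - a) ln T` eventually. Letting `a → 0`, taking the supremum over `P` and summing over
the arms by superadditivity of `liminf` gives the bound. -/

theorem lintegral_pi_prod_eq_prod_lintegral {ι : Type*} [Fintype ι] {α : ι → Type*}
    [∀ i, MeasurableSpace (α i)] (μ : ∀ i, Measure (α i)) [∀ i, IsProbabilityMeasure (μ i)]
    {f : ∀ i, α i → ℝ≥0∞} (hf : ∀ i, Measurable (f i)) :
    ∫⁻ y, ∏ i, f i (y i) ∂(Measure.pi μ) = ∏ i, ∫⁻ x, f i x ∂(μ i) := by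
  refine (lintegral_prod_eq_prod_lintegral_of_indepFun Finset.univ (fun i (y : ∀ i, α i) ↦ f i (y i))
    (iIndepFun_pi fun i ↦ (hf i).aemeasurable)
    fun i ↦ (hf i).comp (measurable_pi_apply i)).trans ?_
  exact Finset.prod_congr rfl fun i _ ↦ (measurePreserving_eval μ i).lintegral_comp (hf i)

theorem pi_eq_withDensity_prod {ι : Type*} [Fintype ι] {α : ι → Type*}
    [∀ i, MeasurableSpace (α i)] (μ μ' : ∀ i, Measure (α i)) [∀ i, IsProbabilityMeasure (μ i)]
    [∀ i, IsProbabilityMeasure (μ' i)] {f : ∀ i, α i → ℝ≥0∞} (hf : ∀ i, Measurable (f i))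
    (h : ∀ i, μ i = (μ' i).withDensity (f i)) :
    Measure.pi μ = (Measure.pi μ').withDensity fun y ↦ ∏ i, f i (y i) := by
  refine Measure.pi_eq fun s hs ↦ ?_
  rw [withDensity_apply _ (MeasurableSet.univ_pi hs),
    ← lintegral_indicator (MeasurableSet.univ_pi hs)]
  have hind : (Set.univ.pi s).indicator (fun y ↦ ∏ i, f i (y i)) =
      fun y ↦ ∏ i, (s i).indicator (f i) (y i) := by
    funext y
    by_cases hy : y ∈ Set.univ.pi s
    · rw [Set.indicator_of_mem hy]
      exact Finset.prod_congr rfl fun i _ ↦ (Set.indicator_of_mem (hy i (Set.mem_univ i)) _).symm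
    · rw [Set.indicator_of_notMem hy]
      simp only [Set.mem_pi, Set.mem_univ, true_imp_iff, not_forall] at hy
      obtain ⟨i, hi⟩ := hy
      exact (Finset.prod_eq_zero (Finset.mem_univ i) (Set.indicator_of_notMem hi _)).symm
  rw [hind, lintegral_pi_prod_eq_prod_lintegral μ' fun i ↦ (hf i).indicator (hs i)]
  refine Finset.prod_congr rfl fun i _ ↦ ?_
  rw [h i, withDensity_apply _ (hs i), lintegral_indicator (hs i)]

section Density

variable {V : Type*} {G : SimpleGraph V} {K : ℕ}

theorem lintegral_agentKernel (Pi : CoopPolicy G K) (ν : Bandit K) (m : V) (t : ℕ)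
    (h : Hist V K t) {φ : Fin K × ℝ → ℝ≥0∞} (hφ : Measurable φ) :
    ∫⁻ y, φ y ∂(agentKernel Pi ν m t h) =
      ∫⁻ k, ∫⁻ x, φ (k, x) ∂(ν k : Measure ℝ)
        ∂(Pi.kernel m t (info Pi.protocol m t h)) := by
  rw [agentKernel, Kernel.lintegral_compProd _ _ _ hφ]
  rfl

/-- The arm is drawn from the same kernel under both instances, so only the reward contributes to
the density. -/
theorem agentKernel_eq_withDensity (Pi : CoopPolicy G K) {ν ν' : Bandit K}
    {w : Fin K × ℝ → ℝ≥0∞} (hw : Measurable w)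
    (hν : ∀ k, (ν k : Measure ℝ) = (ν' k : Measure ℝ).withDensity fun x ↦ w (k, x))
    (m : V) (t : ℕ) (h : Hist V K t) :
    agentKernel Pi ν m t h = (agentKernel Pi ν' m t h).withDensity w := by
  refine Measure.ext_of_lintegral _ fun φ hφ ↦ ?_
  rw [lintegral_withDensity_eq_lintegral_mul _ hw hφ, lintegral_agentKernel Pi ν m t h hφ,
    lintegral_agentKernel Pi ν' m t h (hw.mul hφ)]
  refine lintegral_congr fun k ↦ ?_
  rw [hν k, lintegral_withDensity_eq_lintegral_mul _ (hw.fun_comp measurable_prodMk_left)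
    (hφ.fun_comp measurable_prodMk_left)]
  rfl

variable [Fintype V]

theorem roundKernel_eq_withDensity (Pi : CoopPolicy G K) {ν ν' : Bandit K}
    {w : Fin K × ℝ → ℝ≥0∞} (hw : Measurable w)
    (hν : ∀ k, (ν k : Measure ℝ) = (ν' k : Measure ℝ).withDensity fun x ↦ w (k, x))
    (t : ℕ) (h : Hist V K t) :
    roundKernel Pi ν t h = (roundKernel Pi ν' t h).withDensity fun y ↦ ∏ v, w (y v) :=
  pi_eq_withDensity_prod _ _ (fun _ ↦ hw) fun m ↦ agentKernel_eq_withDensity Pi hw hν m t h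

theorem lintegral_law_succ (Pi : CoopPolicy G K) (ν : Bandit K) (t : ℕ)
    {φ : Hist V K (t + 1) → ℝ≥0∞} (hφ : Measurable φ) :
    ∫⁻ h, φ h ∂(law Pi ν (t + 1)) =
      ∫⁻ h, ∫⁻ y, φ (Fin.snoc (α := fun _ ↦ V → Fin K × ℝ) h y) ∂(roundKernel Pi ν t h)
        ∂(law Pi ν t) := by
  rw [law, lintegral_map hφ measurable_snoc, Measure.lintegral_compProd (hφ.fun_comp measurable_snoc)]

/-- Likelihood ratio of the joint histories: the product of the likelihood ratios of the rewards. -/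
theorem law_eq_withDensity (Pi : CoopPolicy G K) {ν ν' : Bandit K}
    {w : Fin K × ℝ → ℝ≥0∞} (hw : Measurable w)
    (hν : ∀ k, (ν k : Measure ℝ) = (ν' k : Measure ℝ).withDensity fun x ↦ w (k, x)) (T : ℕ) :
    law Pi ν T = (law Pi ν' T).withDensity fun h ↦ ∏ t : Fin T, ∏ v, w (h t v) := by
  have hF : ∀ T, Measurable fun h : Hist V K T ↦ ∏ t : Fin T, ∏ v, w (h t v) := fun T ↦
    Finset.measurable_prod _ fun t _ ↦ Finset.measurable_prod _ fun v _ ↦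
      hw.comp ((measurable_pi_apply v).comp (measurable_pi_apply t))
  have hR : Measurable fun y : V → Fin K × ℝ ↦ ∏ v, w (y v) :=
    Finset.measurable_prod _ fun v _ ↦ hw.comp (measurable_pi_apply v)
  induction T with
  | zero => simp [law]
  | succ T ih =>
    refine Measure.ext_of_lintegral _ fun φ hφ ↦ ?_
    rw [lintegral_withDensity_eq_lintegral_mul _ (hF _) hφ, lintegral_law_succ Pi ν T hφ,
      lintegral_law_succ Pi ν' T ((hF _).mul hφ), ih,
      lintegral_withDensity_eq_lintegral_mul _ (hF T)
        (Measurable.lintegral_kernel_prod_right' (κ := roundKernel Pi ν T)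
          (hφ.fun_comp measurable_snoc))]
    refine lintegral_congr fun h ↦ ?_
    have hφh : Measurable fun y : V → Fin K × ℝ ↦
        φ (Fin.snoc (α := fun _ ↦ V → Fin K × ℝ) h y) :=
      (hφ.comp measurable_snoc).comp measurable_prodMk_left
    change (∏ t : Fin T, ∏ v, w (h t v)) * ∫⁻ y, φ (Fin.snoc h y) ∂(roundKernel Pi ν T h) = _
    rw [roundKernel_eq_withDensity Pi hw hν,
      lintegral_withDensity_eq_lintegral_mul _ hR hφh,
      ← lintegral_const_mul _ (hR.mul hφh)]
    refine lintegral_congr fun y ↦ ?_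
    simp [Fin.prod_univ_castSucc, mul_assoc]

theorem map_eval_roundKernel (Pi : CoopPolicy G K) (ν : Bandit K) (t : ℕ) (h : Hist V K t)
    (v : V) : (roundKernel Pi ν t h).map (fun y ↦ y v) = agentKernel Pi ν v t h :=
  (measurePreserving_eval (fun m ↦ agentKernel Pi ν m t h) v).map_eq

/-- Given the pulled arm, the reward has the law of that arm. -/
theorem lintegral_law_eval (Pi : CoopPolicy G K) (ν : Bandit K) (T : ℕ) (t : Fin T) (v : V)
    {φ : Fin K × ℝ → ℝ≥0∞} (hφ : Measurable φ) :
    ∫⁻ h, φ (h t v) ∂(law Pi ν T) =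
      ∫⁻ h, ∫⁻ x, φ ((h t v).1, x) ∂(ν (h t v).1 : Measure ℝ) ∂(law Pi ν T) := by
  have hφ' : Measurable fun y : Fin K × ℝ ↦ ∫⁻ x, φ (y.1, x) ∂(ν y.1 : Measure ℝ) :=
    (measurable_of_countable fun k : Fin K ↦ ∫⁻ x, φ (k, x) ∂(ν k : Measure ℝ)).comp
      measurable_fst
  have heval : ∀ (T : ℕ) (t : Fin T), Measurable fun h : Hist V K T ↦ h t v := fun T t ↦
    (measurable_pi_apply v).comp (measurable_pi_apply t)
  induction T with
  | zero => exact t.elim0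
  | succ T ih =>
    rw [lintegral_law_succ Pi ν T (hφ.fun_comp (heval _ t)),
      lintegral_law_succ Pi ν T (hφ'.fun_comp (heval _ t))]
    refine Fin.lastCases ?_ (fun t ↦ ?_) t
    · refine lintegral_congr fun h ↦ ?_
      simp only [Fin.snoc_last]
      rw [← lintegral_map (f := φ) (g := fun y : V → Fin K × ℝ ↦ y v) hφ (measurable_pi_apply v),
        ← lintegral_map (g := fun y : V → Fin K × ℝ ↦ y v) hφ' (measurable_pi_apply v),
        map_eval_roundKernel, lintegral_agentKernel Pi ν v T h hφ,
        lintegral_agentKernel Pi ν v T h hφ']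
      simp
    · simpa using ih t

end Density

/-! ### The Bretagnolle–Huber inequality -/

/-- A form of the Bretagnolle–Huber inequality: `exp (-L)` plays the role of (a lower bound for) the
density of `μ'` with respect to `μ`. -/
theorem exp_neg_integral_le_two_mul {Ω : Type*} [MeasurableSpace Ω] (μ μ' : Measure Ω)
    [IsProbabilityMeasure μ] [IsProbabilityMeasure μ'] {L : Ω → ℝ} (hL : Integrable L μ)
    (h : ∀ B, MeasurableSet B → ∫⁻ ω in B, ENNReal.ofReal (Real.exp (-L ω)) ∂μ ≤ μ' B)
    {A : Set Ω} (hA : MeasurableSet A) :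
    Real.exp (-∫ ω, L ω ∂μ) ≤ 2 * (μ.real A + μ'.real Aᶜ) := by
  set S := ∫ ω, L ω ∂μ with hS
  set r := Real.exp (-S / 2) with hr
  have hr0 : 0 < r := Real.exp_pos _
  -- Integrability comes from `h` on the whole space: the total mass is at most `1`.
  have hexp : Integrable (fun ω ↦ Real.exp (-L ω)) μ := by
    refine ⟨Real.continuous_exp.comp_aestronglyMeasurable hL.neg.1, ?_⟩
    rw [hasFiniteIntegral_iff_ofReal (ae_of_all _ fun ω ↦ (Real.exp_pos _).le)]
    have := h Set.univ MeasurableSet.univ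
    rw [Measure.restrict_univ] at this
    exact this.trans_lt (measure_lt_top _ _)
  have hset : ∀ B, MeasurableSet B → ∫ ω in B, Real.exp (-L ω) ∂μ ≤ μ'.real B := fun B hB ↦ by
    rw [integral_eq_lintegral_of_nonneg_ae (ae_of_all _ fun ω ↦ (Real.exp_pos _).le)
      hexp.1.restrict]
    exact ENNReal.toReal_mono (measure_ne_top _ _) (h B hB)
  -- With `u = exp (-L/2)`, the left side is the tangent to `u` at `L = S`, and its integral is `r`
  -- (Jensen). On the right, AM-GM bounds `u` by multiples of `u²` and constants. The weights differ
  -- on `A` and `Aᶜ` so that the terms not controlled by `μ A` or `μ' Aᶜ` integrate to at most `r/4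
  -- + r/4`.
  have hpt : ∀ ω, r * (1 - (L ω - S) / 2) ≤
      A.indicator (fun ω ↦ r / 4 * Real.exp (-L ω) + 1 / r) ω +
        Aᶜ.indicator (fun ω ↦ 1 / r * Real.exp (-L ω) + r / 4) ω := by
    intro ω
    set u := Real.exp (-L ω / 2) with hu
    have hsq : Real.exp (-L ω) = u * u := by rw [hu, ← Real.exp_add]; congr 1; ring
    have htan : r * (1 - (L ω - S) / 2) ≤ u := by
      have : u = r * Real.exp (-(L ω - S) / 2) := by
        rw [hu, hr, ← Real.exp_add]; congr 1; ring
      rw [this]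
      refine mul_le_mul_of_nonneg_left ?_ hr0.le
      linarith [Real.add_one_le_exp (-(L ω - S) / 2)]
    by_cases hω : ω ∈ A
    · rw [Set.indicator_of_mem hω, Set.indicator_of_notMem (by simpa using hω), hsq]
      have : r / 4 * (u * u) + 1 / r - u = (r * u / 2 - 1) ^ 2 / r := by field_simp; ring
      have : 0 ≤ (r * u / 2 - 1) ^ 2 / r := by positivity
      linarith
    · rw [Set.indicator_of_notMem hω, Set.indicator_of_mem (by simpa using hω), hsq]
      have : 1 / r * (u * u) + r / 4 - u = (u - r / 2) ^ 2 / r := by field_simp; ring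
      have : 0 ≤ (u - r / 2) ^ 2 / r := by positivity
      linarith
  have hf₁ : Integrable (fun ω ↦ r / 4 * Real.exp (-L ω) + 1 / r) μ :=
    (hexp.const_mul _).add (integrable_const _)
  have hf₂ : Integrable (fun ω ↦ 1 / r * Real.exp (-L ω) + r / 4) μ :=
    (hexp.const_mul _).add (integrable_const _)
  have hLS : Integrable (fun ω ↦ L ω - S) μ := hL.sub (integrable_const S)
  have hlin : Integrable (fun ω ↦ r * (1 - (L ω - S) / 2)) μ :=
    ((integrable_const (1 : ℝ)).sub (hLS.div_const 2)).const_mul r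
  have hint := integral_mono hlin ((hf₁.indicator hA).add (hf₂.indicator hA.compl)) hpt
  have hleft : ∫ ω, r * (1 - (L ω - S) / 2) ∂μ = r := by
    rw [integral_const_mul, integral_sub (integrable_const _)
      (hLS.div_const 2), integral_div,
      integral_sub hL (integrable_const S)]
    simp [← hS]
  simp only [Pi.add_apply] at hint
  rw [hleft, integral_add (hf₁.indicator hA) (hf₂.indicator hA.compl), integral_indicator hA,
    integral_indicator hA.compl,
    integral_add (hexp.const_mul _).integrableOn (integrable_const _),
    integral_add (hexp.const_mul _).integrableOn (integrable_const _),
    integral_const_mul, integral_const_mul, setIntegral_const, setIntegral_const, smul_eq_mul,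
    smul_eq_mul] at hint
  have h1 : r / 4 * ∫ ω in A, Real.exp (-L ω) ∂μ ≤ r / 4 := by
    have := (hset A hA).trans measureReal_le_one
    nlinarith
  have h2 : 1 / r * ∫ ω in Aᶜ, Real.exp (-L ω) ∂μ ≤ 1 / r * μ'.real Aᶜ :=
    mul_le_mul_of_nonneg_left (hset _ hA.compl) (by positivity)
  have h3 : μ.real Aᶜ * (r / 4) ≤ r / 4 := by
    have : μ.real Aᶜ ≤ 1 := measureReal_le_one
    nlinarith
  have h4 : r / 2 ≤ 1 / r * (μ.real A + μ'.real Aᶜ) := by linarith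
  have h5 : Real.exp (-S) = r * r := by rw [hr, ← Real.exp_add]; congr 1; ring
  rw [h5]
  rw [one_div, inv_mul_eq_div, le_div_iff₀ hr0] at h4
  linarith

/-! ### The expected log-likelihood ratio of the joint histories -/

theorem measurable_hist_eval {V : Type*} {K : ℕ} (T : ℕ) (t : Fin T) (v : V) :
    Measurable fun h : Hist V K T ↦ h t v :=
  (measurable_pi_apply v).comp (measurable_pi_apply t)

section LogLikelihood

variable {V : Type*} [Fintype V] {G : SimpleGraph V} {K : ℕ}

/-- As a composition-product, the law of a single pair gives access to Fubini for integrable, signed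
functions such as log-likelihood ratios. -/
theorem map_law_eval (Pi : CoopPolicy G K) (ν : Bandit K) (T : ℕ) (t : Fin T) (v : V) :
    (law Pi ν T).map (fun h ↦ h t v) =
      ((law Pi ν T).map fun h ↦ (h t v).1) ⊗ₘ rewardKernel ν := by
  have hm := measurable_hist_eval (K := K) T t v
  refine Measure.ext_of_lintegral _ fun φ hφ ↦ ?_
  rw [lintegral_map hφ hm, lintegral_law_eval Pi ν T t v hφ, Measure.lintegral_compProd hφ,
    lintegral_map (measurable_of_countable _) (measurable_fst.fun_comp hm)]
  rfl

variable {ψ : Fin K × ℝ → ℝ} (Pi : CoopPolicy G K) (ν : Bandit K) (T : ℕ) (t : Fin T) (v : V)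

theorem integrable_law_eval (hψ : Measurable ψ)
    (hint : ∀ k, Integrable (fun x ↦ ψ (k, x)) (ν k : Measure ℝ)) :
    Integrable (fun h ↦ ψ (h t v)) (law Pi ν T) := by
  have hm := measurable_hist_eval (K := K) T t v
  have : IsProbabilityMeasure ((law Pi ν T).map fun h ↦ (h t v).1) :=
    Measure.isProbabilityMeasure_map (measurable_fst.comp hm).aemeasurable
  refine (integrable_map_measure hψ.aestronglyMeasurable hm.aemeasurable).1 ?_
  rw [map_law_eval, Measure.integrable_compProd_iff hψ.aestronglyMeasurable]
  exact ⟨ae_of_all _ hint, Integrable.of_finite⟩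

theorem integral_law_eval (hψ : Measurable ψ)
    (hint : ∀ k, Integrable (fun x ↦ ψ (k, x)) (ν k : Measure ℝ)) :
    ∫ h, ψ (h t v) ∂(law Pi ν T) =
      ∫ h, ∫ x, ψ ((h t v).1, x) ∂(ν (h t v).1 : Measure ℝ) ∂(law Pi ν T) := by
  have hm := measurable_hist_eval (K := K) T t v
  have : IsProbabilityMeasure ((law Pi ν T).map fun h ↦ (h t v).1) :=
    Measure.isProbabilityMeasure_map (measurable_fst.comp hm).aemeasurable
  have hi : Integrable ψ ((law Pi ν T).map fun h ↦ h t v) :=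
    (integrable_map_measure hψ.aestronglyMeasurable hm.aemeasurable).2
      (integrable_law_eval Pi ν T t v hψ hint)
  rw [← integral_map hm.aemeasurable hψ.aestronglyMeasurable]
  rw [map_law_eval] at hi ⊢
  rw [Measure.integral_compProd hi, integral_map (measurable_fst.fun_comp hm).aemeasurable
    (measurable_of_countable _).aestronglyMeasurable]
  rfl

end LogLikelihood

/-! ### Pull counts, regret decomposition, and modification of one arm. -/

section Pulls

variable {V : Type*} [Fintype V] {G : SimpleGraph V} {K : ℕ}

/-- The number of pulls of arm `k` by all agents. -/
def pulls {T : ℕ} (k : Fin K) (h : Hist V K T) : ℝ :=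
  ∑ v : V, ∑ t : Fin T, if (h t v).1 = k then (1 : ℝ) else 0

theorem measurable_pulls {T : ℕ} (k : Fin K) : Measurable (pulls (V := V) (T := T) k) :=
  Finset.measurable_sum _ fun v _ ↦ Finset.measurable_sum _ fun t _ ↦
    (measurable_of_countable fun j : Fin K ↦ if j = k then (1 : ℝ) else 0).comp
      (measurable_fst.comp (measurable_hist_eval T t v))

theorem pulls_nonneg {T : ℕ} (k : Fin K) (h : Hist V K T) : 0 ≤ pulls k h :=
  Finset.sum_nonneg fun v _ ↦ Finset.sum_nonneg fun t _ ↦ by split_ifs <;> simp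

theorem sum_mul_pulls {T : ℕ} (c : Fin K → ℝ) (h : Hist V K T) :
    ∑ k, c k * pulls k h = ∑ v : V, ∑ t : Fin T, c (h t v).1 := by
  simp only [pulls, Finset.mul_sum]
  rw [Finset.sum_comm]
  refine Finset.sum_congr rfl fun v _ ↦ ?_
  rw [Finset.sum_comm]
  simp

theorem sum_pulls {T : ℕ} (h : Hist V K T) :
    ∑ k, pulls k h = Fintype.card V * T := by
  simpa using sum_mul_pulls (fun _ ↦ 1) h

theorem integrable_pulls (Pi : CoopPolicy G K) (ν : Bandit K) (T : ℕ) (k : Fin K) :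
    Integrable (pulls k) (law Pi ν T) := by
  refine Integrable.of_bound (measurable_pulls k).aestronglyMeasurable (Fintype.card V * T)
    (ae_of_all _ fun h ↦ ?_)
  rw [Real.norm_of_nonneg (pulls_nonneg k h), ← sum_pulls h]
  exact Finset.single_le_sum (fun j _ ↦ pulls_nonneg j h) (Finset.mem_univ k)

theorem expectedPulls_eq_integral (Pi : CoopPolicy G K) (ν : Bandit K) (T : ℕ) (k : Fin K) :
    expectedPulls Pi ν T k = ∫ h, pulls k h ∂(law Pi ν T) := rfl

theorem expectedPulls_nonneg (Pi : CoopPolicy G K) (ν : Bandit K) (T : ℕ) (k : Fin K) :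
    0 ≤ expectedPulls Pi ν T k := integral_nonneg fun h ↦ pulls_nonneg k h

theorem groupRegret_eq_sum (Pi : CoopPolicy G K) (ν : Bandit K) (T : ℕ) :
    groupRegret Pi ν T = ∑ k, gap ν k * expectedPulls Pi ν T k := by
  simp only [expectedPulls_eq_integral, ← integral_const_mul]
  rw [← integral_finsetSum _ fun k _ ↦ (integrable_pulls Pi ν T k).const_mul _, groupRegret]
  refine integral_congr_ae (ae_of_all _ fun h ↦ ?_)
  simp only [sum_mul_pulls, gap, Finset.sum_sub_distrib]
  simp only [Finset.sum_const, Finset.card_univ, Fintype.card_fin, nsmul_eq_mul]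
  ring

theorem gap_nonneg (ν : Bandit K) (k : Fin K) : 0 ≤ gap ν k :=
  sub_nonneg.2 (le_ciSup (f := fun k ↦ mean (ν k)) (Set.finite_range _).bddAbove k)

theorem mean_le_bestMean (ν : Bandit K) (k : Fin K) : mean (ν k) ≤ bestMean ν :=
  sub_nonneg.1 (gap_nonneg ν k)

/-- Arm `k` now beats the old best mean, so consistency under the modified instance controls every
other arm. -/
theorem gap_update_pos {ν : Bandit K} {k : Fin K} {P : ProbabilityMeasure ℝ}
    (hP : bestMean ν < mean P) {j : Fin K} (hj : j ≠ k) :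
    0 < gap (Function.update ν k P) j := by
  have := mean_le_bestMean (Function.update ν k P) k
  rw [Function.update_self] at this
  rw [gap, Function.update_of_ne hj]
  linarith [mean_le_bestMean ν j]

/-- The data-processing consequence of the divergence decomposition: no event separates an instance
from its modification in one arm better than the expected number of pulls of that arm allows. -/
theorem exp_neg_klDiv_mul_expectedPulls_le (Pi : CoopPolicy G K) (ν : Bandit K) (k : Fin K)
    (P : ProbabilityMeasure ℝ)
    (hkl : InformationTheory.klDiv (ν k : Measure ℝ) (P : Measure ℝ) ≠ ∞) (T : ℕ)
    {A : Set (Hist V K T)} (hA : MeasurableSet A) :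
    Real.exp (-((InformationTheory.klDiv (ν k : Measure ℝ) (P : Measure ℝ)).toReal *
        expectedPulls Pi ν T k)) ≤
      2 * ((law Pi ν T).real A + (law Pi (Function.update ν k P) T).real Aᶜ) := by
  obtain ⟨hac, hint⟩ := InformationTheory.klDiv_ne_top_iff.1 hkl
  set ρ := (ν k : Measure ℝ).rnDeriv (P : Measure ℝ) with hρ
  have hρm : Measurable ρ := Measure.measurable_rnDeriv _ _
  -- The passage through `ℝ` sends the value `∞` to `0`. This changes `ρ` only on a `P`-null set and
  -- makes `hwψ` hold everywhere.
  set w : Fin K × ℝ → ℝ≥0∞ := fun y ↦ if y.1 = k then ENNReal.ofReal (ρ y.2).toReal else 1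
  set ψ : Fin K × ℝ → ℝ := fun y ↦ if y.1 = k then Real.log (ρ y.2).toReal else 0
  have hk : MeasurableSet {y : Fin K × ℝ | y.1 = k} := measurable_fst (measurableSet_singleton k)
  have hw : Measurable w := Measurable.ite hk
    (hρm.comp measurable_snd).ennreal_toReal.ennreal_ofReal measurable_const
  have hψ : Measurable ψ := Measurable.ite hk
    (hρm.comp measurable_snd).ennreal_toReal.log measurable_const
  have hψint : ∀ j, Integrable (fun x ↦ ψ (j, x)) (ν j : Measure ℝ) := fun j ↦ by
    by_cases hj : j = k
    · subst hj; simpa [ψ, llr_def] using hint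
    · simp [ψ, hj]
  have hν : ∀ j, (ν j : Measure ℝ) =
      (Function.update ν k P j : Measure ℝ).withDensity fun x ↦ w (j, x) := fun j ↦ by
    by_cases hj : j = k
    · subst hj
      simp only [Function.update_self, w, if_true]
      conv_lhs => rw [← Measure.withDensity_rnDeriv_eq _ _ hac]
      refine withDensity_congr_ae ?_
      filter_upwards [Measure.rnDeriv_lt_top (ν j : Measure ℝ) (P : Measure ℝ)] with x hx
      exact (ENNReal.ofReal_toReal hx.ne).symm
    · simp [w, hj]
  -- Only an inequality: where the density vanishes, `Real.log 0 = 0` makes the product `0`. Hence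
  -- `exp (-L)` is only a lower bound for the reverse density, and `P ≪ ν k` is not needed.
  have hwψ : ∀ y, w y * ENNReal.ofReal (Real.exp (-ψ y)) ≤ 1 := fun y ↦ by
    simp only [w, ψ]
    split_ifs
    · rw [← ENNReal.ofReal_mul ENNReal.toReal_nonneg, ENNReal.ofReal_le_one]
      rcases (ENNReal.toReal_nonneg (a := ρ y.2)).eq_or_lt with h0 | h0
      · simp [← h0]
      · rw [Real.exp_neg, Real.exp_log h0, mul_inv_cancel₀ h0.ne']
    · simp
  set L : Hist V K T → ℝ := fun h ↦ ∑ t : Fin T, ∑ v : V, ψ (h t v)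
  have hLint : ∀ t v, Integrable (fun h : Hist V K T ↦ ψ (h t v)) (law Pi ν T) := fun t v ↦
    integrable_law_eval Pi ν T t v hψ hψint
  have hL : Integrable L (law Pi ν T) :=
    integrable_finsetSum _ fun t _ ↦ integrable_finsetSum _ fun v _ ↦ hLint t v
  have hLm : Measurable L := Finset.measurable_sum _ fun t _ ↦ Finset.measurable_sum _ fun v _ ↦
    hψ.comp (measurable_hist_eval T t v)
  have hLval : ∫ h, L h ∂(law Pi ν T) =
      (InformationTheory.klDiv (ν k : Measure ℝ) (P : Measure ℝ)).toReal *
        expectedPulls Pi ν T k := by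
    have hD : ∀ j, ∫ x, ψ (j, x) ∂(ν j : Measure ℝ) =
        (InformationTheory.klDiv (ν k : Measure ℝ) (P : Measure ℝ)).toReal *
          if j = k then 1 else 0 := fun j ↦ by
      by_cases hj : j = k
      · subst hj
        rw [InformationTheory.toReal_klDiv_of_measure_eq hac (by simp)]
        simp [ψ, hρ, llr]
      · simp [ψ, hj]
    have hm : ∀ t v, Integrable (fun h : Hist V K T ↦ if (h t v).1 = k then (1 : ℝ) else 0)
        (law Pi ν T) := fun t v ↦
      integrable_law_eval (ψ := fun y ↦ if y.1 = k then 1 else 0) Pi ν T t v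
        (Measurable.ite hk measurable_const measurable_const) fun j ↦ integrable_const (if j = k then (1 : ℝ) else 0)
    rw [integral_finsetSum _ fun t _ ↦ integrable_finsetSum _ fun v _ ↦ hLint t v,
      expectedPulls, integral_finsetSum _ fun v _ ↦ integrable_finsetSum _ fun t _ ↦ hm t v,
      Finset.mul_sum]
    simp_rw [integral_finsetSum _ fun v _ ↦ hLint _ v, integral_finsetSum _ fun t _ ↦ hm t _,
      Finset.mul_sum]
    rw [Finset.sum_comm]
    refine Finset.sum_congr rfl fun v _ ↦ Finset.sum_congr rfl fun t _ ↦ ?_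
    rw [integral_law_eval Pi ν T t v hψ hψint, ← integral_const_mul]
    simp_rw [hD]
  rw [← hLval]
  refine exp_neg_integral_le_two_mul _ _ hL (fun B hB ↦ ?_) hA
  have hF : Measurable fun h : Hist V K T ↦ ∏ t : Fin T, ∏ v, w (h t v) :=
    Finset.measurable_prod _ fun t _ ↦ Finset.measurable_prod _ fun v _ ↦
      hw.comp (measurable_hist_eval T t v)
  rw [law_eq_withDensity Pi hw hν T, setLIntegral_withDensity_eq_setLIntegral_mul _ hF
    hLm.fun_neg.exp.ennreal_ofReal hB]
  refine (setLIntegral_mono (g := 1) measurable_const fun h _ ↦ ?_).trans (by simp)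
  have hexp : ENNReal.ofReal (Real.exp (-L h)) =
      ∏ t : Fin T, ∏ v, ENNReal.ofReal (Real.exp (-ψ (h t v))) := by
    simp only [L, ← Finset.sum_neg_distrib, Real.exp_sum]
    rw [ENNReal.ofReal_prod_of_nonneg fun t _ ↦ Finset.prod_nonneg fun v _ ↦ (Real.exp_pos _).le]
    exact Finset.prod_congr rfl fun t _ ↦
      ENNReal.ofReal_prod_of_nonneg fun v _ ↦ (Real.exp_pos _).le
  simp only [_root_.Pi.mul_apply, _root_.Pi.one_apply, hexp, ← Finset.prod_mul_distrib]
  exact Finset.prod_le_one' fun t _ ↦ Finset.prod_le_one' fun v _ ↦ hwψ _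

end Pulls

/-! ### Asymptotics -/

section Asymptotic

variable {V : Type*} [Fintype V] {G : SimpleGraph V} {K : ℕ}

theorem mul_measureReal_le_expectedPulls (Pi : CoopPolicy G K) (ν : Bandit K) (T : ℕ) (k : Fin K)
    (c : ℝ) : c * (law Pi ν T).real {h | c ≤ pulls k h} ≤ expectedPulls Pi ν T k :=
  mul_meas_ge_le_integral_of_nonneg (ae_of_all _ fun h ↦ pulls_nonneg k h)
    (integrable_pulls Pi ν T k) c

/-- The counts add up to `MT`, so if `k` gets less than half of the pulls, the other arms together
get more than half. Markov applies to their sum. -/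
theorem mul_measureReal_compl_le_sum_expectedPulls (Pi : CoopPolicy G K) (ν : Bandit K) (T : ℕ)
    (k : Fin K) :
    (Fintype.card V * T / 2 : ℝ) *
        (law Pi ν T).real {h | (Fintype.card V * T / 2 : ℝ) ≤ pulls k h}ᶜ ≤
      ∑ j ∈ Finset.univ.erase k, expectedPulls Pi ν T j := by
  simp only [expectedPulls_eq_integral]
  rw [← integral_finsetSum _ fun j _ ↦ integrable_pulls Pi ν T j]
  refine le_trans ?_ (mul_meas_ge_le_integral_of_nonneg
    (ae_of_all _ fun h ↦ Finset.sum_nonneg fun j _ ↦ pulls_nonneg j h)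
    (integrable_finsetSum _ fun j _ ↦ integrable_pulls Pi ν T j) (Fintype.card V * T / 2))
  refine mul_le_mul_of_nonneg_left (measureReal_mono fun h hh ↦ ?_) (by positivity)
  have hsum := sum_pulls h
  rw [← Finset.add_sum_erase _ _ (Finset.mem_univ k)] at hsum
  simp only [Set.mem_compl_iff, Set.mem_ofPred_eq, not_le] at hh ⊢
  linarith

theorem eventually_mul_log_le_klDiv_mul_expectedPulls [Nonempty V]
    {𝓜 : Fin K → Set (ProbabilityMeasure ℝ)} {Pi : ℕ → CoopPolicy G K} (hPi : IsConsistent 𝓜 Pi)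
    {ν : Bandit K} (hν : ν ∈ envClass 𝓜) {k : Fin K} (hk : 0 < gap ν k)
    {P : ProbabilityMeasure ℝ} (hP : P ∈ 𝓜 k) (hmean : bestMean ν < mean P)
    (hkl : InformationTheory.klDiv (ν k : Measure ℝ) (P : Measure ℝ) ≠ ∞) {a : ℝ} (ha : 0 < a) :
    ∀ᶠ T : ℕ in atTop, (1 - a) * Real.log T ≤
      (InformationTheory.klDiv (ν k : Measure ℝ) (P : Measure ℝ)).toReal *
        expectedPulls (Pi T) ν T k := by
  set ν' := Function.update ν k P with hν'
  have hmem : ν' ∈ envClass 𝓜 := fun j ↦ by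
    by_cases hj : j = k
    · subst hj; simpa [hν'] using hP
    · simpa [hν', hj] using hν j
  have hM : (0 : ℝ) < Fintype.card V := by exact_mod_cast Fintype.card_pos
  have ho : (fun T : ℕ ↦ expectedPulls (Pi T) ν T k +
      ∑ j ∈ Finset.univ.erase k, expectedPulls (Pi T) ν' T j) =o[atTop]
        fun T : ℕ ↦ (T : ℝ) ^ a :=
    (hPi ν hν k hk a ha).add <| Asymptotics.IsLittleO.fun_sum fun j hj ↦
      hPi ν' hmem j (gap_update_pos hmean (Finset.ne_of_mem_erase hj)) a ha
  -- The constant `M/4` absorbs the factor `2` of Bretagnolle–Huber and the factor `2/M` of Markov,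
  -- leaving exactly `T^(a-1)`.
  filter_upwards [ho.bound (div_pos hM four_pos), eventually_gt_atTop 0] with T hT hT0
  have hT0' : (0 : ℝ) < T := by exact_mod_cast hT0
  rw [Real.norm_of_nonneg (Real.rpow_nonneg hT0'.le a)] at hT
  replace hT := (le_abs_self _).trans hT
  have hA : MeasurableSet {h : Hist V K T | (Fintype.card V * T / 2 : ℝ) ≤ pulls k h} :=
    measurableSet_le measurable_const (measurable_pulls k)
  have h1 := mul_measureReal_le_expectedPulls (Pi T) ν T k (Fintype.card V * T / 2)
  have h2 := mul_measureReal_compl_le_sum_expectedPulls (Pi T) ν' T k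
  have h3 := exp_neg_klDiv_mul_expectedPulls_le (Pi T) ν k P hkl T hA
  have h4 : Real.exp (-((InformationTheory.klDiv (ν k : Measure ℝ) (P : Measure ℝ)).toReal *
        expectedPulls (Pi T) ν T k)) ≤ Real.exp ((a - 1) * Real.log T) := by
    refine h3.trans ?_
    rw [mul_comm (a - 1), ← Real.rpow_def_of_pos hT0', Real.rpow_sub_one hT0'.ne',
      le_div_iff₀ hT0']
    refine le_of_mul_le_mul_left ?_ (div_pos hM four_pos)
    linarith
  linarith [Real.exp_le_exp.1 h4]

theorem ofReal_gap_div_Dinf_le_liminf [Nonempty V]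
    {𝓜 : Fin K → Set (ProbabilityMeasure ℝ)} {Pi : ℕ → CoopPolicy G K} (hPi : IsConsistent 𝓜 Pi)
    {ν : Bandit K} (hν : ν ∈ envClass 𝓜) {k : Fin K} (hk : 0 < gap ν k) :
    ((ENNReal.ofReal (gap ν k) / Dinf 𝓜 ν k : ℝ≥0∞) : EReal) ≤
      liminf (fun T : ℕ ↦ ((gap ν k * expectedPulls (Pi T) ν T k / Real.log T : ℝ) : EReal))
        atTop := by
  set X := liminf (fun T : ℕ ↦
    ((gap ν k * expectedPulls (Pi T) ν T k / Real.log T : ℝ) : EReal)) atTop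
  have hX : 0 ≤ X := le_liminf_of_le (by isBoundedDefault) <| Eventually.of_forall fun T ↦ by
    exact_mod_cast div_nonneg (mul_nonneg hk.le (expectedPulls_nonneg _ _ _ _))
      (Real.log_natCast_nonneg T)
  -- In `ℝ≥0∞` the inverse of an infimum is a supremum, so one `P` at a time suffices. This also
  -- covers an empty infimum and an infimum equal to `0`.
  rw [← EReal.coe_toENNReal hX, EReal.coe_ennreal_le_coe_ennreal_iff, Dinf, div_eq_mul_inv]
  simp only [ENNReal.inv_iInf, ENNReal.mul_iSup]
  refine iSup₂_le fun P ⟨hP, hmean⟩ ↦ ?_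
  by_cases hkl : InformationTheory.klDiv (ν k : Measure ℝ) (P : Measure ℝ) = ∞
  · simp [hkl]
  have hev := fun {a : ℝ} (ha : 0 < a) ↦
    eventually_mul_log_le_klDiv_mul_expectedPulls hPi hν hk hP hmean hkl ha
  rw [← ENNReal.ofReal_toReal hkl]
  set D := (InformationTheory.klDiv (ν k : Measure ℝ) (P : Measure ℝ)).toReal
  have hlog : ∀ᶠ T : ℕ in atTop, 0 < Real.log T :=
    (Real.tendsto_log_atTop.comp tendsto_natCast_atTop_atTop).eventually_gt_atTop 0
  -- Consistency itself excludes `D = 0`: with `a = 1/2` it would force `ln T ≤ 0` for large `T`.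
  have hD : 0 < D := by
    refine ENNReal.toReal_nonneg.lt_of_ne fun h0 ↦ ?_
    obtain ⟨T, hT, hT'⟩ := ((hev one_half_pos).and hlog).exists
    change 0 = D at h0
    rw [← h0] at hT
    linarith
  rw [← ENNReal.ofReal_inv_of_pos hD, ← ENNReal.ofReal_mul hk.le,
    ← EReal.coe_ennreal_le_coe_ennreal_iff, EReal.coe_toENNReal hX, EReal.coe_ennreal_ofReal,
    max_eq_left (by positivity)]
  have hlim : Tendsto (fun a : ℝ ↦ ((gap ν k * ((1 - a) * D⁻¹) : ℝ) : EReal)) (𝓝[>] 0)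
      (𝓝 ((gap ν k * D⁻¹ : ℝ) : EReal)) := by
    refine (continuous_coe_real_ereal.tendsto _).comp (tendsto_nhdsWithin_of_tendsto_nhds ?_)
    have : Continuous fun a : ℝ ↦ gap ν k * ((1 - a) * D⁻¹) := by fun_prop
    simpa using this.tendsto 0
  refine le_of_tendsto hlim ?_
  filter_upwards [self_mem_nhdsWithin] with a ha
  refine le_liminf_of_le (by isBoundedDefault) ?_
  filter_upwards [hev ha, hlog] with T hT hT'
  rw [EReal.coe_le_coe_iff, mul_div_assoc]
  refine mul_le_mul_of_nonneg_left ?_ hk.le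
  rw [← div_eq_mul_inv, div_le_div_iff₀ hD hT']
  linarith

end Asymptotic

/-! ### Summation over the arms. -/

theorem coe_sum_le_liminf_sum {ι : Type*} {s : Finset ι} {c : ι → ℝ≥0∞} {u : ι → ℕ → ℝ}
    (h : ∀ i ∈ s, (c i : EReal) ≤ liminf (fun n ↦ (u i n : EReal)) atTop) :
    ((∑ i ∈ s, c i : ℝ≥0∞) : EReal) ≤
      liminf (fun n ↦ ((∑ i ∈ s, u i n : ℝ) : EReal)) atTop := by
  classical
  induction s using Finset.induction_on with
  | empty => simp
  | insert i s hi ih =>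
    simp only [Finset.sum_insert hi, EReal.coe_ennreal_add, EReal.coe_add]
    refine (add_le_add (h i (Finset.mem_insert_self i s))
      (ih fun j hj ↦ h j (Finset.mem_insert_of_mem hj))).trans ?_
    exact EReal.le_liminf_add

theorem theorem1 {V : Type*} [Fintype V] (G : SimpleGraph V) (hG : G.Connected) (K : ℕ)
    (𝓜 : Fin K → Set (ProbabilityMeasure ℝ))
    (h𝓜 : ∀ k, ∀ P ∈ 𝓜 k, Integrable (fun x : ℝ ↦ x) (P : Measure ℝ))
    (Pi : ℕ → CoopPolicy G K) (hPi : IsConsistent 𝓜 Pi)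
    (ν : Bandit K) (hν : ν ∈ envClass 𝓜) :
    ((∑ k : Fin K with 0 < gap ν k, ENNReal.ofReal (gap ν k) / Dinf 𝓜 ν k : ℝ≥0∞) : EReal) ≤
      liminf (fun T : ℕ ↦ ((groupRegret (Pi T) ν T / Real.log T : ℝ) : EReal)) atTop := by
  -- Connectedness provides at least one agent, so that `M > 0` in the Markov bounds.
  have := hG.nonempty
  have hreg : ∀ T, groupRegret (Pi T) ν T / Real.log T =
      ∑ k : Fin K with 0 < gap ν k, gap ν k * expectedPulls (Pi T) ν T k / Real.log T := fun T ↦ by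
    rw [groupRegret_eq_sum, ← Finset.sum_div, Finset.sum_filter_of_ne fun k _ hne ↦
      (gap_nonneg ν k).lt_of_ne fun h0 ↦ hne (by rw [← h0, zero_mul])]
  simp only [hreg]
  exact coe_sum_le_liminf_sum fun k hk ↦
    ofReal_gap_div_Dinf_le_liminf hPi hν (Finset.mem_filter.1 hk).2
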